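/- Let $k\ge 1$ and $n\ge k$. The input is a uniformly random permutation $(e_1,\dots,e_n)$ of $\{1,\dots,n\}$; the pivots are $e_1,\dots,e_k$, in sorted order $p_1<\dots<p_k$. An element $e_i$ with $i>k$ belongs to group $A_h$ ($0\le h\le k$) if exactly $h$ pivots are smaller than it, and $a_h=|A_h|$. A *comparison tree* is a binary search tree with inner nodes $p_1,\dots,p_k$ in inorder and leaves $A_0,\dots,A_k$ from left to right; classifying an element of $A_h$ with the comparison tree $\lambda$ takes $\mathrm{depth}_\lambda(A_h)$ comparisons. Let $\mathrm{cost}^\lambda(b_0,\dots,b_k)=\sum_{h}\mathrm{depth}_\lambda(A_h)\,b_h$. A *classification tree* is a $(k+1)$-way tree in which every inner node $v$ carries an index $i(v)\in\{k+1,\dots,n\}$ and a comparison tree $\lambda(v)$, every index occurring exactly once on each path from the root to a leaf; at $v$ the element $e_{i(v)}$ is classified with $\lambda(v)$, and one continues in the $h$-th child if $e_{i(v)}\in A_h$. Let $a^v_h$ be the number of edges labeled $h$ on the path from the root to $v$. A classification strategy is given by a classification tree, which for the strategies $\mathcal O_k$ and $\mathcal N_k$ below may depend on $(a_0,\dots,a_k)$.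 Its average comparison count $\mathrm E(P_n)$ is the expected total number of comparisons made when classifying $e_{k+1},\dots,e_n$. Consider the following strategies, where the order of classification and the choice among cost-minimal comparison trees are arbitrary. * $\mathcal O_k$: given $a_0,\dots,a_k$, at every node $v$ that can be reached, $\lambda(v)$ minimizes $\mathrm{cost}^\lambda(a_0-a^v_0,\dots,a_k-a^v_k)$ over all comparison trees $\lambda$. * $\mathcal N_k$: given $a_0,\dots,a_k$, at every node $v$, $\lambda(v)$ minimizes $\mathrm{cost}^\lambda(a_0,\dots,a_k)$ over all comparison trees $\lambda$. * $\mathcal{SP}_k$ (which does not know $a_0,\dots,a_k$): with an arbitrary comparison tree $\lambda_0$, the first $n^{3/4}$ elements (rounded up or down; all elements if there are fewer) are classified with $\lambda_0$. Let $a'_0,\dots,a'_k$ be the numbers of these elements found in $A_0,\dots,A_k$. All remaining elements are classified with one comparison tree that minimizes $\mathrm{cost}^\lambda(a'_0,\dots,a'_k)$. **Theorem.** The strategy $\mathcal{SP}_k$ is asymptotically optimal for every $k\ge1$, that is, its average comparison count differs from that of $\mathcal O_k$ by $O(n^{1-\varepsilon})$; likewise it differs from that of $\mathcal N_k$ by $O(n^{1-\varepsilon})$.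 Precisely, there is $\varepsilon>0$ such that for every $k\ge 1$ there is a constant $C$ such that for all $n\ge k$, for every choice of $\lambda_0$ and of the classification orders and cost-minimal trees in the strategies, $$\bigl|\mathrm E(P_n^{\mathcal{SP}_k})-\mathrm E(P_n^{\mathcal O_k})\bigr|\le C\,n^{1-\varepsilon}\quad\text{and}\quad\bigl|\mathrm E(P_n^{\mathcal{SP}_k})-\mathrm E(P_n^{\mathcal N_k})\bigr|\le C\,n^{1-\varepsilon}.$$ -/

import Mathlib

open scoped Nat

namespace KPivot

/-- Binary search trees whose leaves are, from left to right, the groups `A_a, …, A_b`, and whose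
inner nodes are, in inorder, the pivots `p_{a+1}, …, p_b`. The root of `node j l r` is `p_{j+1}`. -/
inductive SearchTree : ℕ → ℕ → Type
  | leaf (a : ℕ) : SearchTree a a
  | node {a b : ℕ} (j : ℕ) (l : SearchTree a j) (r : SearchTree (j + 1) b) : SearchTree a b

/-- The comparison trees for `k` pivots (the set `Λ_k`). -/
abbrev ComparisonTree (k : ℕ) : Type := SearchTree 0 k

/-- The depth of the leaf `A_h`: the number of comparisons made when searching for an element of
`A_h`. At a node `p_{j+1}` the search goes left if and only if the element is smaller than
`p_{j+1}`, that is, if and only if `h ≤ j`. -/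
def SearchTree.depth : {a b : ℕ} → SearchTree a b → ℕ → ℕ
  | _, _, .leaf _, _ => 0
  | _, _, .node j l r, h => 1 + if h ≤ j then l.depth h else r.depth h

/-- `cost^t(a_0, …, a_k) = ∑ h, depth_t(A_h) * a_h`. -/
def cost {k : ℕ} (t : ComparisonTree k) (a : Fin (k + 1) → ℕ) : ℕ :=
  ∑ h : Fin (k + 1), t.depth h.val * a h

/-- `t` has minimal cost for the group sizes `a` among all comparison trees. -/
def IsCostMinimal {k : ℕ} (a : Fin (k + 1) → ℕ) (t : ComparisonTree k) : Prop :=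
  ∀ t' : ComparisonTree k, cost t a ≤ cost t' a

/-- Classification trees in which the elements at the positions in `s` are still unclassified.
A node carries the position `i` of the element to be classified next and the comparison tree `t`
used for it, and has one child for each outcome; on every path to a leaf each position in `s`
occurs exactly once. -/
inductive ClassificationTree (k : ℕ) {n : ℕ} : Finset (Fin n) → Type
  | leaf : ClassificationTree k ∅
  | node {s : Finset (Fin n)} (i : Fin n) (hi : i ∈ s) (t : ComparisonTree k)
      (child : Fin (k + 1) → ClassificationTree k (s.erase i)) : ClassificationTree k s

/-- The number of comparisons made in the classification, where `g i` is the group of the element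
at position `i`. -/
def ClassificationTree.comparisons {k n : ℕ} (g : Fin n → Fin (k + 1)) :
    {s : Finset (Fin n)} → ClassificationTree k s → ℕ
  | _, .leaf => 0
  | _, .node i _ t child => t.depth (g i).val + (child (g i)).comparisons g

/-- Every inner node `v` satisfies `P c t`, where `t` is its comparison tree and `c h` is the number
of edges labeled `h` on the path to `v`; the argument `c` is this count for the root. -/
def ClassificationTree.AllNodes {k n : ℕ} (P : (Fin (k + 1) → ℕ) → ComparisonTree k → Prop) :
    {s : Finset (Fin n)} → ClassificationTree k s → (Fin (k + 1) → ℕ) → Prop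
  | _, .leaf, _ => True
  | _, .node _ _ t child, c => P c t ∧ ∀ h, (child h).AllNodes P (c + Pi.single h 1)

/-- The positions of the elements to be classified; the positions `0, …, k - 1` hold the pivots. -/
def nonPivots (n k : ℕ) : Finset (Fin n) := Finset.univ.filter fun i => k ≤ i.val

/-- The group of the element `σ i` of the input `σ`: the number of pivots smaller than it. -/
def group {n : ℕ} (k : ℕ) (σ : Equiv.Perm (Fin n)) (i : Fin n) : Fin (k + 1) :=
  ⟨(Finset.univ.filter fun j : Fin n => j.val < k ∧ σ j < σ i).card, by
    have h : (Finset.univ.filter fun j : Fin n => j.val < k ∧ σ j < σ i).card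
        ≤ (Finset.range k).card :=
      Finset.card_le_card_of_injOn (fun j => j.val)
        (fun j hj => by simp at hj ⊢; exact hj.1) (fun _ _ _ _ h => Fin.ext h)
    rw [Finset.card_range] at h
    exact Nat.lt_succ_of_le h⟩

/-- The size `a_h` of the group `A_h`. -/
def groupSize {n : ℕ} (k : ℕ) (σ : Equiv.Perm (Fin n)) (h : Fin (k + 1)) : ℕ :=
  ((nonPivots n k).filter fun i => group k σ i = h).card

/-- Strategies that may know the group sizes: a classification tree for each vector of group
sizes. A strategy that does not know them is a constant function. -/
abbrev Strategy (k n : ℕ) : Type := (Fin (k + 1) → ℕ) → ClassificationTree k (nonPivots n k)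

/-- The average comparison count of a strategy over all permutations of an input of length `n`. -/
noncomputable def avgComparisons {k n : ℕ} (S : Strategy k n) : ℝ :=
  (∑ σ : Equiv.Perm (Fin n), ((S (groupSize k σ)).comparisons (group k σ) : ℝ)) / (n ! : ℝ)

/-- The strategy `O_k`: the comparison tree at a node is one with minimal cost for the group sizes
of the unclassified elements. (A node with `c h > a h` for some `h` is never reached.) -/
def IsO {k n : ℕ} (S : Strategy k n) : Prop :=
  ∀ a : Fin (k + 1) → ℕ, ∑ h, a h = n - k →
    (S a).AllNodes (fun c t => c ≤ a → IsCostMinimal (a - c) t) 0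

/-- The strategy `N_k`: the comparison tree at a node is one with minimal cost for the group
sizes of the input. -/
def IsN {k n : ℕ} (S : Strategy k n) : Prop :=
  ∀ a : Fin (k + 1) → ℕ, ∑ h, a h = n - k → (S a).AllNodes (fun _ t => IsCostMinimal a t) 0

/-- The next `m` elements are classified with `t₀`, and all elements after them with one comparison
tree that has minimal cost for the numbers of elements found in each group so far; the argument `c`
holds these numbers for the elements classified already. -/
def ClassificationTree.SamplesThenFixes {k n : ℕ} (t₀ : ComparisonTree k) :
    {s : Finset (Fin n)} → ClassificationTree k s → ℕ → (Fin (k + 1) → ℕ) → Prop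
  | _, T, 0, c => ∃ t, IsCostMinimal c t ∧ T.AllNodes (fun _ t' => t' = t) c
  | _, .leaf, _ + 1, _ => True
  | _, .node _ _ t child, m + 1, c =>
      t = t₀ ∧ ∀ h, (child h).SamplesThenFixes t₀ m (c + Pi.single h 1)

/-- The strategy `SP_k` with initial comparison tree `t₀`; the sample size `n^{3/4}` may be rounded
up or down. -/
def IsSP {k n : ℕ} (t₀ : ComparisonTree k) (T : ClassificationTree k (nonPivots n k)) : Prop :=
  ∃ m : ℕ, |(m : ℝ) - (n : ℝ) ^ (3 / 4 : ℝ)| < 1 ∧ T.SamplesThenFixes t₀ m 0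

end KPivot

/-!
Conditioned on the group sizes `a`, classifying an element is a draw without replacement from an urn
with `a h` elements of group `h`, whatever the order of classification. The proportions `q` of the
groups in the urn hardly change: the squared deviation of the remaining group sizes from `q` grows
by at most `1` per draw in expectation. The mean depth of a cost-minimal comparison tree is a
Lipschitz function of the proportions of the group sizes it is chosen for, so the trees of `O_k`,
of `N_k`, and the one that `SP_k` chooses after its sample, have almost the same mean depth on the
remaining elements. With sample size and number of elements about `n^{3/4}` and `n`, balancing the
errors by the weight `l = n^{1/4}` in the inequality `2 |y| ≤ 1 / l + l * y ^ 2` gives `n^{3/4}`.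
-/

namespace KPivot

section Urn

theorem single_one_le {ι : Type*} [DecidableEq ι] {R : ι → ℕ} {h : ι} (hR : 0 < R h) :
    Pi.single h 1 ≤ R := by
  intro i
  rcases eq_or_ne i h with rfl | hi
  · simpa using Nat.one_le_iff_ne_zero.mpr hR.ne'
  · simp [hi]

variable {ι : Type*} [Fintype ι]

/-- The proportion of group `h` in an urn with `R h` elements of each group `h`. It is `0` for an
empty urn. -/
noncomputable def proportion (R : ι → ℕ) (h : ι) : ℝ := R h / (∑ i, R i : ℕ)

/-- The expected value of `f h`, where `h` is the group of an element drawn uniformly at random from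
an urn with `R h` elements of each group `h`. -/
noncomputable def urnMean (R : ι → ℕ) (f : ι → ℝ) : ℝ := ∑ h, proportion R h * f h

/-- The sum of the squared deviations of the group sizes `R` from those of the same total with
proportions `q`. -/
noncomputable def deviation (q : ι → ℝ) (R : ι → ℕ) : ℝ :=
  ∑ h, (R h - (∑ i, R i : ℕ) * q h) ^ 2

/-- A potential that bounds the expected sum, over the draws that empty an urn with group sizes
`R`, of the squared distances between `q` and the proportions in the urn. -/
noncomputable def driftPotential (q : ι → ℝ) (R : ι → ℕ) : ℝ :=
  deviation q R / (∑ h, R h : ℕ) + harmonic (∑ h, R h)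

/-- A potential that bounds the expected sum, over the draws that empty an urn with group sizes
`R`, of the `ℓ¹` distances between `q` and the proportions in the urn, for every weight `l > 0`. -/
noncomputable def distancePotential (l : ℝ) (q : ι → ℝ) (R : ι → ℕ) : ℝ :=
  (Fintype.card ι / l * (∑ h, R h : ℕ) + l * driftPotential q R) / 2

theorem proportion_nonneg (R : ι → ℕ) (h : ι) : 0 ≤ proportion R h :=
  div_nonneg (Nat.cast_nonneg _) (Nat.cast_nonneg _)

theorem sum_mul_proportion (R : ι → ℕ) (h : ι) : (∑ i, R i : ℕ) * proportion R h = R h :=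
  mul_div_cancel_of_imp' fun h0 => by
    rw [Nat.cast_eq_zero, Finset.sum_eq_zero_iff] at h0
    exact_mod_cast h0 h (Finset.mem_univ h)

theorem sum_proportion {R : ι → ℕ} (hR : ∑ h, R h ≠ 0) : ∑ h, proportion R h = 1 := by
  simp only [proportion]
  rw [← Finset.sum_div, ← Nat.cast_sum]
  exact div_self (Nat.cast_ne_zero.mpr hR)

theorem urnMean_add (R : ι → ℕ) (f g : ι → ℝ) :
    urnMean R (fun h => f h + g h) = urnMean R f + urnMean R g := by
  simp only [urnMean, mul_add, Finset.sum_add_distrib]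

theorem urnMean_const_mul (R : ι → ℕ) (x : ℝ) (f : ι → ℝ) :
    urnMean R (fun h => x * f h) = x * urnMean R f := by
  simp only [urnMean, Finset.mul_sum, mul_left_comm]

theorem urnMean_const {R : ι → ℕ} (hR : ∑ h, R h ≠ 0) (x : ℝ) : urnMean R (fun _ => x) = x := by
  rw [urnMean, ← Finset.sum_mul, sum_proportion hR, one_mul]

theorem urnMean_mono {R : ι → ℕ} {f g : ι → ℝ} (hfg : ∀ h, 0 < R h → f h ≤ g h) :
    urnMean R f ≤ urnMean R g := by
  refine Finset.sum_le_sum fun h _ => ?_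
  rcases Nat.eq_zero_or_pos (R h) with h0 | h0
  · simp [proportion, h0]
  · exact mul_le_mul_of_nonneg_left (hfg h h0) (proportion_nonneg R h)

theorem urnMean_congr {R : ι → ℕ} {f g : ι → ℝ} (hfg : ∀ h, 0 < R h → f h = g h) :
    urnMean R f = urnMean R g :=
  (urnMean_mono fun h h0 => (hfg h h0).le).antisymm (urnMean_mono fun h h0 => (hfg h h0).ge)

theorem abs_urnMean_le (R : ι → ℕ) (f : ι → ℝ) : |urnMean R f| ≤ urnMean R fun h => |f h| :=
  (Finset.abs_sum_le_sum_abs _ _).trans_eq <| Finset.sum_congr rfl fun h _ => by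
    rw [abs_mul, abs_of_nonneg (proportion_nonneg R h)]

theorem deviation_nonneg (q : ι → ℝ) (R : ι → ℕ) : 0 ≤ deviation q R :=
  Finset.sum_nonneg fun _ _ => sq_nonneg _

theorem deviation_proportion_self (R : ι → ℕ) : deviation (proportion R) R = 0 :=
  Finset.sum_eq_zero fun h _ => by rw [sum_mul_proportion, sub_self, zero_pow two_ne_zero]

theorem deviation_div_sq {R : ι → ℕ} (hR : ∑ h, R h ≠ 0) (q : ι → ℝ) :
    deviation q R / (∑ h, R h : ℕ) ^ 2 = ∑ h, (proportion R h - q h) ^ 2 := by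
  have hR' : ((∑ h, R h : ℕ) : ℝ) ≠ 0 := Nat.cast_ne_zero.mpr hR
  rw [deviation, Finset.sum_div]
  refine Finset.sum_congr rfl fun h _ => ?_
  rw [← div_pow, sub_div, mul_div_cancel_left₀ _ hR', proportion]

theorem deviation_proportion_add (c R : ι → ℕ) :
    deviation (proportion (c + R)) c = deviation (proportion (c + R)) R := by
  refine Finset.sum_congr rfl fun h _ => ?_
  have hsum := sum_mul_proportion (c + R) h
  simp only [Pi.add_apply, Finset.sum_add_distrib, Nat.cast_add, add_mul] at hsum
  rw [← neg_sq]
  congr 1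
  linarith

theorem sum_abs_le_div_add_sum_sq (y : ι → ℝ) {l : ℝ} (hl : 0 < l) :
    ∑ i, |y i| ≤ (Fintype.card ι / l + l * ∑ i, y i ^ 2) / 2 := by
  have abs_le_of_sq (z : ℝ) : |z| ≤ (1 / l + l * z ^ 2) / 2 := by
    have hsq : (1 / l + l * z ^ 2) / 2 - |z| = (l * |z| - 1) ^ 2 / (2 * l) := by
      rw [← sq_abs z]
      field_simp
      ring
    exact sub_nonneg.mp (hsq ▸ by positivity)
  calc ∑ i, |y i| ≤ ∑ i, (1 / l + l * y i ^ 2) / 2 := Finset.sum_le_sum fun i _ => abs_le_of_sq _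
    _ = (Fintype.card ι / l + l * ∑ i, y i ^ 2) / 2 := by
      rw [← Finset.sum_div, Finset.sum_add_distrib, ← Finset.mul_sum, Finset.sum_const,
        Finset.card_univ, nsmul_eq_mul, mul_one_div]

theorem sum_abs_proportion_sub_le (q : ι → ℝ) {R : ι → ℕ} (hR : ∑ h, R h ≠ 0) {l : ℝ}
    (hl : 0 < l) :
    ∑ h, |proportion R h - q h|
      ≤ (Fintype.card ι / l + l * (deviation q R / (∑ h, R h : ℕ) ^ 2)) / 2 := by
  rw [deviation_div_sq hR]
  exact sum_abs_le_div_add_sum_sq _ hl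

theorem one_div_sum_le_sum_proportion_sq {R : ι → ℕ} (hR : ∑ h, R h ≠ 0) :
    1 / (∑ h, R h : ℕ) ≤ ∑ h, proportion R h ^ 2 := by
  have hR' : (0 : ℝ) < (∑ h, R h : ℕ) := Nat.cast_pos.mpr (Nat.pos_of_ne_zero hR)
  have hsq : ((∑ h, R h : ℕ) : ℝ) ≤ ∑ h, (R h : ℝ) ^ 2 := by
    exact_mod_cast Finset.sum_le_sum fun h _ => Nat.le_self_pow two_ne_zero (R h)
  simp only [proportion, div_pow, ← Finset.sum_div]
  rw [div_le_div_iff₀ hR' (by positivity), one_mul, sq]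
  gcongr

variable [DecidableEq ι]

theorem sum_add_single_one (R : ι → ℕ) (h : ι) :
    ∑ i, (R + Pi.single h 1 : ι → ℕ) i = ∑ i, R i + 1 := by
  simp [Finset.sum_add_distrib]

theorem sum_sub_single_one {R : ι → ℕ} {h : ι} (hR : 0 < R h) :
    ∑ i, (R - Pi.single h 1 : ι → ℕ) i = ∑ i, R i - 1 := by
  have hsum := sum_add_single_one (R - Pi.single h 1) h
  rw [tsub_add_cancel_of_le (single_one_le hR)] at hsum
  omega

theorem urnMean_sub_indicator_sq {R : ι → ℕ} (hR : ∑ h, R h ≠ 0) (i : ι) (x : ℝ) :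
    urnMean R (fun h => (x - (Pi.single h 1 : ι → ℝ) i) ^ 2)
      = x ^ 2 + proportion R i * (1 - 2 * x) := by
  have expand (h : ι) : (x - (Pi.single h 1 : ι → ℝ) i) ^ 2
      = x ^ 2 + if i = h then 1 - 2 * x else 0 := by
    rw [Pi.single_apply]
    split_ifs <;> ring
  simp only [expand, urnMean_add, urnMean_const hR]
  simp [urnMean]

theorem urnMean_deviation_sub_single_eq (q : ι → ℝ) {R : ι → ℕ} (hR : ∑ h, R h ≠ 0) :
    urnMean R (fun h => deviation q (R - Pi.single h 1))
      = (1 - 1 / (∑ h, R h : ℕ)) ^ 2 * deviation q R + (1 - ∑ h, proportion R h ^ 2) := by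
  set j : ℝ := ((∑ h, R h : ℕ) : ℝ) with hj
  have hj0 : j ≠ 0 := Nat.cast_ne_zero.mpr hR
  have deviation_eq (h : ι) (h0 : 0 < R h) : deviation q (R - Pi.single h 1)
      = ∑ i, (R i - (j - 1) * q i - (Pi.single h 1 : ι → ℝ) i) ^ 2 := by
    refine Finset.sum_congr rfl fun i _ => ?_
    rw [sum_sub_single_one h0, Nat.cast_pred (Nat.pos_of_ne_zero hR), ← hj, Pi.sub_apply,
      Nat.cast_sub (single_one_le h0 i), sub_right_comm]
    simp [Pi.single_apply]
  have coordinate (i : ι) : (R i - (j - 1) * q i) ^ 2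
      + proportion R i * (1 - 2 * (R i - (j - 1) * q i))
      = (1 - 1 / j) ^ 2 * (R i - j * q i) ^ 2 + (proportion R i - proportion R i ^ 2) := by
    rw [proportion, ← hj]
    field_simp
    ring
  calc urnMean R (fun h => deviation q (R - Pi.single h 1))
      = ∑ i, urnMean R (fun h => (R i - (j - 1) * q i - (Pi.single h 1 : ι → ℝ) i) ^ 2) := by
        rw [urnMean_congr deviation_eq]
        simp only [urnMean, Finset.mul_sum]
        exact Finset.sum_comm
    _ = ∑ i, ((1 - 1 / j) ^ 2 * (R i - j * q i) ^ 2
          + (proportion R i - proportion R i ^ 2)) := by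
        simp only [urnMean_sub_indicator_sq hR, coordinate]
    _ = (1 - 1 / j) ^ 2 * deviation q R + (1 - ∑ h, proportion R h ^ 2) := by
        rw [Finset.sum_add_distrib, ← Finset.mul_sum, Finset.sum_sub_distrib, sum_proportion hR,
          deviation]

theorem urnMean_deviation_sub_single_le (q : ι → ℝ) {R : ι → ℕ} (hR : ∑ h, R h ≠ 0) :
    urnMean R (fun h => deviation q (R - Pi.single h 1))
      ≤ (1 - 1 / (∑ h, R h : ℕ)) ^ 2 * deviation q R + (1 - 1 / (∑ h, R h : ℕ)) := by
  rw [urnMean_deviation_sub_single_eq q hR]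
  gcongr
  exact one_div_sum_le_sum_proportion_sq hR

theorem urnMean_deviation_sub_single_le_add_one (q : ι → ℝ) {R : ι → ℕ} (hR : ∑ h, R h ≠ 0) :
    urnMean R (fun h => deviation q (R - Pi.single h 1)) ≤ deviation q R + 1 := by
  have hinv0 : (0 : ℝ) ≤ 1 / (∑ h, R h : ℕ) := by positivity
  have hinv1 : 1 / ((∑ h, R h : ℕ) : ℝ) ≤ 1 := by
    rw [one_div]
    exact Nat.cast_inv_le_one _
  refine (urnMean_deviation_sub_single_le q hR).trans (add_le_add ?_ (by linarith))
  exact mul_le_of_le_one_left (deviation_nonneg q R)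
    (pow_le_one₀ (by linarith) (by linarith))

theorem deviation_div_sq_add_urnMean_driftPotential_le (q : ι → ℝ) {R : ι → ℕ}
    (hR : ∑ h, R h ≠ 0) :
    deviation q R / (∑ h, R h : ℕ) ^ 2 + urnMean R (fun h => driftPotential q (R - Pi.single h 1))
      ≤ driftPotential q R := by
  obtain ⟨j, hj⟩ := Nat.exists_eq_succ_of_ne_zero hR
  have hdrift := urnMean_deviation_sub_single_le q hR
  have hmean : urnMean R (fun h => driftPotential q (R - Pi.single h 1))
      = (j : ℝ)⁻¹ * urnMean R (fun h => deviation q (R - Pi.single h 1)) + harmonic j := by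
    rw [← urnMean_const_mul, ← urnMean_const hR (harmonic j : ℝ), ← urnMean_add]
    refine urnMean_congr fun h h0 => ?_
    rw [driftPotential, sum_sub_single_one h0, hj, Nat.succ_sub_one, div_eq_inv_mul]
  rw [hmean, driftPotential, hj, harmonic_succ]
  rw [hj] at hdrift
  rcases Nat.eq_zero_or_pos j with rfl | hj0
  · simp
  calc deviation q R / (j + 1 : ℕ) ^ 2
        + ((j : ℝ)⁻¹ * urnMean R (fun h => deviation q (R - Pi.single h 1)) + harmonic j)
      ≤ deviation q R / (j + 1 : ℕ) ^ 2
        + ((j : ℝ)⁻¹ * ((1 - 1 / (j + 1 : ℕ)) ^ 2 * deviation q R + (1 - 1 / (j + 1 : ℕ)))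
          + harmonic j) := by gcongr
    _ = deviation q R / (j + 1 : ℕ) + (harmonic j + ((j + 1 : ℕ) : ℚ)⁻¹ : ℚ) := by
        push_cast
        field_simp
        ring

theorem sum_abs_add_urnMean_distancePotential_le {l : ℝ} (hl : 0 < l) (q : ι → ℝ) {R : ι → ℕ}
    (hR : ∑ h, R h ≠ 0) :
    ∑ h, |proportion R h - q h|
        + urnMean R (fun h => distancePotential l q (R - Pi.single h 1))
      ≤ distancePotential l q R := by
  have hmean : urnMean R (fun h => distancePotential l q (R - Pi.single h 1))
      = Fintype.card ι / l * ((∑ h, R h : ℕ) - 1) / 2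
        + l / 2 * urnMean R (fun h => driftPotential q (R - Pi.single h 1)) := by
    rw [← urnMean_const_mul, ← urnMean_const hR (_ / 2), ← urnMean_add]
    refine urnMean_congr fun h h0 => ?_
    rw [distancePotential, sum_sub_single_one h0, Nat.cast_pred (Nat.pos_of_ne_zero hR)]
    ring
  have hdist := sum_abs_proportion_sub_le q hR hl
  have hdrift :=
    mul_le_mul_of_nonneg_left (deviation_div_sq_add_urnMean_driftPotential_le q hR) hl.le
  rw [hmean, distancePotential]
  linarith

end Urn

section ComparisonTree

variable {k : ℕ}

theorem SearchTree.le {a b : ℕ} (t : SearchTree a b) : a ≤ b := by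
  induction t with
  | leaf => exact le_rfl
  | node => omega

theorem SearchTree.depth_le {a b : ℕ} (t : SearchTree a b) (h : ℕ) : t.depth h ≤ b - a := by
  induction t with
  | leaf => exact Nat.zero_le _
  | node j l r ihl ihr =>
    have hl := l.le
    have hr := r.le
    simp only [SearchTree.depth]
    split_ifs <;> omega

instance : Nonempty (ComparisonTree k) := by
  induction k with
  | zero => exact ⟨.leaf 0⟩
  | succ k ih => exact ih.map fun t => .node k t (.leaf (k + 1))

theorem exists_isCostMinimal (a : Fin (k + 1) → ℕ) : ∃ t, IsCostMinimal a t :=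
  ⟨Function.argmin fun t : ComparisonTree k => cost t a,
    fun t' => Function.argmin_le (fun t => cost t a) t'⟩

theorem cost_add (t : ComparisonTree k) (x y : Fin (k + 1) → ℕ) :
    cost t (x + y) = cost t x + cost t y := by
  simp only [cost, Pi.add_apply, mul_add, Finset.sum_add_distrib]

theorem cost_single_one (t : ComparisonTree k) (h : Fin (k + 1)) :
    cost t (Pi.single h 1) = t.depth h := by
  simp [cost, Pi.single_apply]

theorem depth_add_cost_sub_single_one (t : ComparisonTree k) {R : Fin (k + 1) → ℕ}
    {h : Fin (k + 1)} (hR : 0 < R h) : t.depth h + cost t (R - Pi.single h 1) = cost t R := by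
  rw [← cost_single_one, ← cost_add, add_tsub_cancel_of_le (single_one_le hR)]

theorem cost_le (t : ComparisonTree k) (a : Fin (k + 1) → ℕ) : cost t a ≤ k * ∑ h, a h := by
  rw [cost, Finset.mul_sum]
  exact Finset.sum_le_sum fun h _ => Nat.mul_le_mul_right _ (SearchTree.depth_le t h)

/-- The expected number of comparisons made when classifying, with the comparison tree `t`, a random
element from groups of sizes `R`. -/
noncomputable def meanDepth (t : ComparisonTree k) (R : Fin (k + 1) → ℕ) : ℝ :=
  urnMean R fun h => t.depth h

theorem sum_mul_meanDepth (t : ComparisonTree k) (R : Fin (k + 1) → ℕ) :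
    (∑ h, R h : ℕ) * meanDepth t R = cost t R := by
  simp only [meanDepth, urnMean, Finset.mul_sum, cost]
  rw [Nat.cast_sum _ fun h : Fin (k + 1) => t.depth h * R h]
  refine Finset.sum_congr rfl fun h _ => ?_
  rw [← mul_assoc, sum_mul_proportion, Nat.cast_mul, mul_comm]

theorem abs_meanDepth_le (t : ComparisonTree k) {R : Fin (k + 1) → ℕ} (hR : ∑ h, R h ≠ 0) :
    |meanDepth t R| ≤ k := by
  refine (abs_urnMean_le R _).trans ?_
  rw [← urnMean_const hR (k : ℝ)]
  refine urnMean_mono fun h _ => ?_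
  rw [Nat.abs_cast]
  exact_mod_cast SearchTree.depth_le t h

theorem abs_meanDepth_sub_le (t : ComparisonTree k) (x y : Fin (k + 1) → ℕ) :
    |meanDepth t x - meanDepth t y| ≤ k * ∑ h, |proportion x h - proportion y h| := by
  simp only [meanDepth, urnMean, ← Finset.sum_sub_distrib, ← sub_mul, Finset.mul_sum]
  refine (Finset.abs_sum_le_sum_abs _ _).trans (Finset.sum_le_sum fun h _ => ?_)
  rw [abs_mul, Nat.abs_cast, mul_comm]
  gcongr
  exact SearchTree.depth_le t h

theorem IsCostMinimal.meanDepth_le {a : Fin (k + 1) → ℕ} {t : ComparisonTree k}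
    (ht : IsCostMinimal a t) (t' : ComparisonTree k) : meanDepth t a ≤ meanDepth t' a := by
  rcases Nat.eq_zero_or_pos (∑ h, a h) with ha | ha
  · simp [meanDepth, urnMean, proportion, ha]
  · refine le_of_mul_le_mul_left ?_ (Nat.cast_pos.mpr ha : (0 : ℝ) < _)
    rw [sum_mul_meanDepth, sum_mul_meanDepth]
    exact_mod_cast ht t'

theorem IsCostMinimal.abs_meanDepth_sub_le {x y : Fin (k + 1) → ℕ} {t u : ComparisonTree k}
    (ht : IsCostMinimal x t) (hu : IsCostMinimal y u) :
    |meanDepth t x - meanDepth u y| ≤ k * ∑ h, |proportion x h - proportion y h| := by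
  have hlower := (abs_le.mp (KPivot.abs_meanDepth_sub_le t x y)).1
  have hupper := (abs_le.mp (KPivot.abs_meanDepth_sub_le u x y)).2
  rw [abs_le]
  constructor <;> linarith [ht.meanDepth_le u, hu.meanDepth_le t]

theorem IsCostMinimal.abs_cost_add_sub_le {c R : Fin (k + 1) → ℕ} {t u : ComparisonTree k}
    (ht : IsCostMinimal c t) (hu : IsCostMinimal (c + R) u) (hc : ∑ h, c h ≠ 0) {l : ℝ}
    (hl : 0 < l) :
    |(cost t (c + R) : ℝ) - cost u (c + R)| ≤ k * (∑ h, (c + R) h : ℕ)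
      * ((k + 1) / l + l * (deviation (proportion (c + R)) R / (∑ h, c h : ℕ) ^ 2)) := by
  set q := proportion (c + R)
  have hdist : ∑ h, |proportion c h - q h|
      ≤ ((k + 1) / l + l * (deviation q R / (∑ h, c h : ℕ) ^ 2)) / 2 := by
    rw [← deviation_proportion_add]
    simpa using sum_abs_proportion_sub_le q hc hl
  have hmean : |meanDepth t (c + R) - meanDepth u (c + R)|
      ≤ 2 * (k * ∑ h, |proportion c h - q h|) := by
    have hfirst := KPivot.abs_meanDepth_sub_le t c (c + R)
    have hsecond := ht.abs_meanDepth_sub_le hu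
    rw [abs_sub_comm] at hfirst
    linarith [abs_sub_le (meanDepth t (c + R)) (meanDepth t c) (meanDepth u (c + R))]
  rw [← sum_mul_meanDepth, ← sum_mul_meanDepth, ← mul_sub, abs_mul, Nat.abs_cast,
    mul_comm (k : ℝ), mul_assoc]
  gcongr
  calc |meanDepth t (c + R) - meanDepth u (c + R)|
      ≤ 2 * (k * ∑ h, |proportion c h - q h|) := hmean
    _ ≤ 2 * (k * (((k + 1) / l + l * (deviation q R / (∑ h, c h : ℕ) ^ 2)) / 2)) := by gcongr
    _ = k * ((k + 1) / l + l * (deviation q R / (∑ h, c h : ℕ) ^ 2)) := by ring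

end ComparisonTree

section Exchangeability

variable {n k : ℕ} {s : Finset (Fin n)} {R : Fin (k + 1) → ℕ} {A : Finset (Equiv.Perm (Fin n))}

/-- The expected number of comparisons if the groups of the elements are drawn without replacement
from an urn with `R h` elements of each group `h`. -/
noncomputable def ClassificationTree.expectedComparisons {k n : ℕ} :
    {s : Finset (Fin n)} → ClassificationTree k s → (Fin (k + 1) → ℕ) → ℝ
  | _, .leaf, _ => 0
  | _, .node _ _ t child, R =>
      urnMean R fun h => t.depth h + (child h).expectedComparisons (R - Pi.single h 1)

/-- Every input in `A` has `R h` elements of each group `h` at the non-pivot positions in `s`, and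
`A` is closed under exchanging elements at these positions. -/
structure IsExchangeable (s : Finset (Fin n)) (R : Fin (k + 1) → ℕ)
    (A : Finset (Equiv.Perm (Fin n))) : Prop where
  subset_nonPivots : s ⊆ nonPivots n k
  mul_swap_mem : ∀ i ∈ s, ∀ j ∈ s, ∀ σ ∈ A, σ * Equiv.swap i j ∈ A
  card_filter_group : ∀ σ ∈ A, ∀ h, {i ∈ s | group k σ i = h}.card = R h

theorem group_mul_swap {i j : Fin n} (hi : i ∈ nonPivots n k) (hj : j ∈ nonPivots n k)
    (σ : Equiv.Perm (Fin n)) (x : Fin n) :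
    group k (σ * Equiv.swap i j) x = group k σ (Equiv.swap i j x) := by
  simp only [nonPivots, Finset.mem_filter, Finset.mem_univ, true_and] at hi hj
  refine Fin.ext ?_
  simp only [group, Equiv.Perm.mul_apply]
  congr 1
  refine Finset.filter_congr fun y _ => and_congr_right fun hy => ?_
  rw [Equiv.swap_apply_of_ne_of_ne (by rintro rfl; omega) (by rintro rfl; omega)]

theorem groupSize_mul_swap {i j : Fin n} (hi : i ∈ nonPivots n k) (hj : j ∈ nonPivots n k)
    (σ : Equiv.Perm (Fin n)) : groupSize k (σ * Equiv.swap i j) = groupSize k σ := by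
  have swap_mem (x : Fin n) (hx : x ∈ nonPivots n k) : Equiv.swap i j x ∈ nonPivots n k := by
    rw [Equiv.swap_apply_def]
    split_ifs <;> assumption
  funext h
  simp only [groupSize, group_mul_swap hi hj]
  refine Finset.card_equiv (Equiv.swap i j) fun x => ?_
  simp only [Finset.mem_filter]
  refine and_congr_left fun _ => ⟨swap_mem x, fun hx => ?_⟩
  simpa using swap_mem _ hx

theorem isExchangeable_groupSize (n k : ℕ) (a : Fin (k + 1) → ℕ) :
    IsExchangeable (nonPivots n k) a {σ | groupSize k σ = a} where
  subset_nonPivots := Finset.Subset.rfl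
  mul_swap_mem i hi j hj σ hσ := by
    simpa [groupSize_mul_swap hi hj] using hσ
  card_filter_group σ hσ h := congrFun (Finset.mem_filter.mp hσ).2 h

namespace IsExchangeable

theorem sum_eq_card (hA : IsExchangeable s R A) (hne : A.Nonempty) : ∑ h, R h = s.card := by
  obtain ⟨σ, hσ⟩ := hne
  rw [Finset.card_eq_sum_card_fiberwise (f := group k σ) (t := Finset.univ) (by simp)]
  exact Finset.sum_congr rfl fun h _ => (hA.card_filter_group σ hσ h).symm

theorem card_filter_group_eq (hA : IsExchangeable s R A) {i j : Fin n} (hi : i ∈ s) (hj : j ∈ s)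
    (h : Fin (k + 1)) : {σ ∈ A | group k σ j = h}.card = {σ ∈ A | group k σ i = h}.card := by
  refine Finset.card_equiv (Equiv.mulRight (Equiv.swap i j)) fun σ => ?_
  have hmem : σ * Equiv.swap i j ∈ A ↔ σ ∈ A :=
    ⟨fun hσ => by simpa [mul_assoc] using hA.mul_swap_mem i hi j hj _ hσ,
      hA.mul_swap_mem i hi j hj σ⟩
  rw [Equiv.coe_mulRight, Finset.mem_filter, Finset.mem_filter, hmem,
    group_mul_swap (hA.subset_nonPivots hi) (hA.subset_nonPivots hj), Equiv.swap_apply_left]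

theorem card_mul_card_filter_group (hA : IsExchangeable s R A) {i : Fin n} (hi : i ∈ s)
    (h : Fin (k + 1)) : s.card * {σ ∈ A | group k σ i = h}.card = A.card * R h := by
  calc s.card * {σ ∈ A | group k σ i = h}.card
      = ∑ j ∈ s, {σ ∈ A | group k σ j = h}.card := by
        rw [Finset.sum_congr rfl fun j hj => hA.card_filter_group_eq hi hj h, Finset.sum_const,
          smul_eq_mul]
    _ = ∑ σ ∈ A, {j ∈ s | group k σ j = h}.card := by
        simp only [Finset.card_filter]
        exact Finset.sum_comm
    _ = A.card * R h := by
        rw [Finset.sum_congr rfl fun σ hσ => hA.card_filter_group σ hσ h, Finset.sum_const,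
          smul_eq_mul]

theorem card_filter_group_eq_mul_proportion (hA : IsExchangeable s R A) (hne : A.Nonempty)
    {i : Fin n} (hi : i ∈ s) (h : Fin (k + 1)) :
    ({σ ∈ A | group k σ i = h}.card : ℝ) = A.card * proportion R h := by
  have hs : (s.card : ℝ) ≠ 0 := Nat.cast_ne_zero.mpr (Finset.card_pos.mpr ⟨i, hi⟩).ne'
  rw [proportion, hA.sum_eq_card hne, ← mul_div_assoc, eq_div_iff hs, mul_comm]
  exact_mod_cast hA.card_mul_card_filter_group hi h

theorem erase (hA : IsExchangeable s R A) {i : Fin n} (hi : i ∈ s) (h : Fin (k + 1)) :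
    IsExchangeable (s.erase i) (R - Pi.single h 1) {σ ∈ A | group k σ i = h} where
  subset_nonPivots := (Finset.erase_subset _ _).trans hA.subset_nonPivots
  mul_swap_mem x hx y hy σ hσ := by
    rw [Finset.mem_filter] at hσ ⊢
    rw [Finset.mem_erase] at hx hy
    refine ⟨hA.mul_swap_mem x hx.2 y hy.2 σ hσ.1, ?_⟩
    rw [group_mul_swap (hA.subset_nonPivots hx.2) (hA.subset_nonPivots hy.2),
      Equiv.swap_apply_of_ne_of_ne hx.1.symm hy.1.symm, hσ.2]
  card_filter_group σ hσ h' := by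
    rw [Finset.mem_filter] at hσ
    rw [Finset.filter_erase, Pi.sub_apply, ← hA.card_filter_group σ hσ.1 h']
    rcases eq_or_ne h' h with rfl | hne
    · rw [Pi.single_eq_same, Finset.card_erase_of_mem (by simp [hi, hσ.2])]
    · rw [Pi.single_eq_of_ne hne, Finset.erase_eq_of_notMem (by simp [hσ.2, hne.symm]),
        Nat.sub_zero]

theorem sum_comparisons_eq (hA : IsExchangeable s R A) (T : ClassificationTree k s) :
    ∑ σ ∈ A, (T.comparisons (group k σ) : ℝ) = A.card * T.expectedComparisons R := by
  induction T generalizing R A with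
  | leaf => simp [ClassificationTree.comparisons, ClassificationTree.expectedComparisons]
  | node i hi t child ih =>
    rcases A.eq_empty_or_nonempty with rfl | hne
    · simp
    rw [← Finset.sum_fiberwise A (fun σ => group k σ i), ClassificationTree.expectedComparisons,
      urnMean, Finset.mul_sum]
    refine Finset.sum_congr rfl fun h _ => ?_
    rw [← mul_assoc, ← hA.card_filter_group_eq_mul_proportion hne hi, mul_add,
      ← ih h (hA.erase hi h), ← nsmul_eq_mul, ← Finset.sum_const, ← Finset.sum_add_distrib]
    refine Finset.sum_congr rfl fun σ hσ => ?_
    rw [ClassificationTree.comparisons, (Finset.mem_filter.mp hσ).2, Nat.cast_add]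

end IsExchangeable

theorem card_nonPivots (n k : ℕ) : (nonPivots n k).card = n - k := by
  have hcard := Finset.card_filter_add_card_filter_not
    (s := (Finset.univ : Finset (Fin n))) fun i => i.val < k
  simp only [not_lt, Finset.card_univ, Fintype.card_fin, Fin.card_filter_val_lt] at hcard
  rw [nonPivots]
  omega

theorem sum_groupSize (k : ℕ) (σ : Equiv.Perm (Fin n)) : ∑ h, groupSize k σ h = n - k := by
  rw [← card_nonPivots]
  exact (isExchangeable_groupSize n k (groupSize k σ)).sum_eq_card ⟨σ, by simp⟩

theorem avgComparisons_eq (S : Strategy k n) :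
    avgComparisons S
      = (∑ σ : Equiv.Perm (Fin n), (S (groupSize k σ)).expectedComparisons (groupSize k σ))
        / (n ! : ℝ) := by
  have hmaps : ∀ σ ∈ (Finset.univ : Finset (Equiv.Perm (Fin n))),
      groupSize k σ ∈ Finset.univ.image (groupSize k) := fun σ hσ => Finset.mem_image_of_mem _ hσ
  rw [avgComparisons, ← Finset.sum_fiberwise_of_maps_to hmaps,
    ← Finset.sum_fiberwise_of_maps_to hmaps]
  congr 1
  refine Finset.sum_congr rfl fun a _ => ?_
  have hgroup (f : (Fin (k + 1) → ℕ) → Equiv.Perm (Fin n) → ℝ) :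
      ∑ σ with groupSize k σ = a, f (groupSize k σ) σ = ∑ σ with groupSize k σ = a, f a σ :=
    Finset.sum_congr rfl fun σ hσ => by rw [(Finset.mem_filter.mp hσ).2]
  rw [hgroup fun b σ => ((S b).comparisons (group k σ) : ℝ),
    hgroup fun b _ => (S b).expectedComparisons b,
    (isExchangeable_groupSize n k a).sum_comparisons_eq, Finset.sum_const, nsmul_eq_mul]

theorem abs_avgComparisons_sub_le {S S' : Strategy k n} {B : ℝ}
    (h : ∀ a, ∑ h, a h = n - k →
      |(S a).expectedComparisons a - (S' a).expectedComparisons a| ≤ B) :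
    |avgComparisons S - avgComparisons S'| ≤ B := by
  have hn : (0 : ℝ) < n ! := by exact_mod_cast n.factorial_pos
  rw [avgComparisons_eq, avgComparisons_eq, ← sub_div, abs_div, abs_of_pos hn, div_le_iff₀ hn,
    ← Finset.sum_sub_distrib]
  calc |∑ σ : Equiv.Perm (Fin n), ((S (groupSize k σ)).expectedComparisons (groupSize k σ)
        - (S' (groupSize k σ)).expectedComparisons (groupSize k σ))|
      ≤ ∑ _σ : Equiv.Perm (Fin n), B := (Finset.abs_sum_le_sum_abs _ _).trans
        (Finset.sum_le_sum fun σ _ => h _ (sum_groupSize k σ))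
    _ = B * n ! := by
      rw [Finset.sum_const, Finset.card_univ, Fintype.card_perm, Fintype.card_fin, nsmul_eq_mul,
        mul_comm]

end Exchangeability

section Estimates

variable {n k : ℕ} {s : Finset (Fin n)} {T : ClassificationTree k s} {a c R : Fin (k + 1) → ℕ}

namespace ClassificationTree

theorem expectedComparisons_eq_cost {t : ComparisonTree k}
    (hT : T.AllNodes (fun _ t' => t' = t) c) (hR : ∑ h, R h = s.card) :
    T.expectedComparisons R = cost t R := by
  induction T generalizing c R with
  | leaf =>
    have hR0 : R = 0 := funext (by simpa using hR)
    simp [expectedComparisons, cost, hR0]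
  | node i hi t' child ih =>
    obtain ⟨rfl, hchild⟩ := hT
    have hR0 : ∑ h, R h ≠ 0 := hR ▸ (Finset.card_pos.mpr ⟨i, hi⟩).ne'
    rw [expectedComparisons, ← urnMean_const hR0 (cost t' R : ℝ)]
    refine urnMean_congr fun h h0 => ?_
    rw [ih h (hchild h) (by rw [sum_sub_single_one h0, hR, Finset.card_erase_of_mem hi])]
    exact_mod_cast depth_add_cost_sub_single_one t' h0

theorem abs_expectedComparisons_node_sub_le {i : Fin n} {hi : i ∈ s} {t : ComparisonTree k}
    {child : Fin (k + 1) → ClassificationTree k (s.erase i)} (hR : ∑ h, R h ≠ 0) (w : ℝ) {W : ℝ}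
    {V : Fin (k + 1) → ℝ}
    (hV : ∀ h, 0 < R h → |(child h).expectedComparisons (R - Pi.single h 1) - W| ≤ V h) :
    |(node i hi t child).expectedComparisons R - (w + W)|
      ≤ |meanDepth t R - w| + urnMean R V := by
  have hsplit : (node i hi t child).expectedComparisons R - (w + W) = (meanDepth t R - w)
      + urnMean R (fun h => (child h).expectedComparisons (R - Pi.single h 1) + -W) := by
    rw [expectedComparisons, urnMean_add, urnMean_add, urnMean_const hR, meanDepth]
    ring
  rw [hsplit]
  refine (abs_add_le _ _).trans (add_le_add le_rfl ((abs_urnMean_le R _).trans ?_))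
  exact urnMean_mono fun h h0 => by simpa only [← sub_eq_add_neg] using hV h h0

theorem abs_expectedComparisons_sub_le_of_potential
    {P : (Fin (k + 1) → ℕ) → ComparisonTree k → Prop} {μ : ℝ} {V : (Fin (k + 1) → ℕ) → ℝ}
    (hV0 : 0 ≤ V 0)
    (hV : ∀ c R t, c + R = a → ∑ h, R h ≠ 0 → P c t →
      |meanDepth t R - μ| + urnMean R (fun h => V (R - Pi.single h 1)) ≤ V R)
    (hcR : c + R = a) (hR : ∑ h, R h = s.card) (hT : T.AllNodes P c) :
    |T.expectedComparisons R - (∑ h, R h : ℕ) * μ| ≤ V R := by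
  induction T generalizing c R with
  | leaf =>
    have hR0 : R = 0 := funext (by simpa using hR)
    simpa [expectedComparisons, hR0] using hV0
  | node i hi t child ih =>
    obtain ⟨ht, hchild⟩ := hT
    have hR0 : ∑ h, R h ≠ 0 := hR ▸ (Finset.card_pos.mpr ⟨i, hi⟩).ne'
    have hstep (h : Fin (k + 1)) (h0 : 0 < R h) :
        |(child h).expectedComparisons (R - Pi.single h 1) - ((∑ h, R h : ℕ) - 1) * μ|
          ≤ V (R - Pi.single h 1) := by
      have hih := ih h (R := R - Pi.single h 1) (c := c + Pi.single h 1)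
        (by rw [add_assoc, add_tsub_cancel_of_le (single_one_le h0), hcR])
        (by rw [sum_sub_single_one h0, hR, Finset.card_erase_of_mem hi]) (hchild h)
      rwa [sum_sub_single_one h0, Nat.cast_pred (Nat.pos_of_ne_zero hR0)] at hih
    have hsum : (∑ h, R h : ℕ) * μ = μ + ((∑ h, R h : ℕ) - 1) * μ := by ring
    rw [hsum]
    exact (abs_expectedComparisons_node_sub_le hR0 μ hstep).trans (hV c R t hcR hR0 ht)

theorem abs_expectedComparisons_sub_cost_le_of_allNodes
    {P : (Fin (k + 1) → ℕ) → ComparisonTree k → Prop} {u : ComparisonTree k} {l : ℝ} (hl : 0 < l)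
    (hP : ∀ c R t, c + R = a → P c t →
      |meanDepth t R - meanDepth u a| ≤ k * ∑ h, |proportion R h - proportion a h|)
    (ha : ∑ h, a h = s.card) (hT : T.AllNodes P 0) :
    |T.expectedComparisons a - cost u a|
      ≤ k * (((k + 1) / l * s.card + l * harmonic s.card) / 2) := by
  have hpotential := abs_expectedComparisons_sub_le_of_potential (μ := meanDepth u a)
    (V := fun R => k * distancePotential l (proportion a) R)
    (by simp [distancePotential, driftPotential, deviation])
    (fun c R t hcR hR ht => by
      rw [urnMean_const_mul]
      refine (add_le_add (hP c R t hcR ht) le_rfl).trans ?_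
      rw [← mul_add]
      gcongr
      exact sum_abs_add_urnMean_distancePotential_le hl _ hR)
    (zero_add a) ha hT
  rw [sum_mul_meanDepth] at hpotential
  simpa [distancePotential, driftPotential, deviation_proportion_self, ha] using hpotential

theorem abs_expectedComparisons_sub_le_of_samplesThenFixes {t₀ : ComparisonTree k} {S r : ℕ}
    {M α β : ℝ} (hβ : 0 ≤ β) (hsmall : ∑ h, a h ≤ S → |M| ≤ α) (q : Fin (k + 1) → ℝ)
    (hfix : ∀ c R t, c + R = a → ∑ h, c h = S → IsCostMinimal c t →
      |cost t R - M| ≤ α + β * deviation q R)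
    (hcR : c + R = a) (hR : ∑ h, R h = s.card) (hc : ∑ h, c h + r = S)
    (hT : T.SamplesThenFixes t₀ r c) :
    |T.expectedComparisons R - M| ≤ k * r + α + β * (deviation q R + r) := by
  induction r generalizing s c R with
  | zero =>
    obtain ⟨t, ht, hnodes⟩ : ∃ t, IsCostMinimal c t ∧ T.AllNodes (fun _ t' => t' = t) c := by
      cases T <;> exact hT
    rw [expectedComparisons_eq_cost hnodes hR]
    simpa using hfix c R t hcR hc ht
  | succ r ih =>
    cases T with
    | leaf =>
      have hR0 : R = 0 := funext (by simpa using hR)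
      have hα : |M| ≤ α := hsmall (by rw [← hcR, hR0, add_zero]; omega)
      rw [expectedComparisons, zero_sub, abs_neg]
      have hdev := deviation_nonneg q R
      exact hα.trans (by rw [add_right_comm]; exact le_add_of_nonneg_left (by positivity))
    | node i hi t child =>
      have hR0 : ∑ h, R h ≠ 0 := hR ▸ (Finset.card_pos.mpr ⟨i, hi⟩).ne'
      have hstep (h : Fin (k + 1)) (h0 : 0 < R h) :
          |(child h).expectedComparisons (R - Pi.single h 1) - M|
            ≤ k * r + α + β * (deviation q (R - Pi.single h 1) + r) :=
        ih (c := c + Pi.single h 1)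
          (by rw [add_assoc, add_tsub_cancel_of_le (single_one_le h0), hcR])
          (by rw [sum_sub_single_one h0, hR, Finset.card_erase_of_mem hi])
          (by rw [sum_add_single_one]; omega) (hT.2 h)
      have hnode := abs_expectedComparisons_node_sub_le (hi := hi) (t := t) hR0 0 hstep
      rw [zero_add, sub_zero, urnMean_add, urnMean_const hR0, urnMean_const_mul, urnMean_add,
        urnMean_const hR0] at hnode
      have hdrift :=
        mul_le_mul_of_nonneg_left (urnMean_deviation_sub_single_le_add_one q hR0) hβ
      push_cast
      linarith [abs_meanDepth_le t hR0]

theorem abs_expectedComparisons_sub_cost_le_of_samplesThenFixes {t₀ u : ComparisonTree k} {S : ℕ}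
    (hS : S ≠ 0) {l : ℝ} (hl : 0 < l) (hu : IsCostMinimal a u) (ha : ∑ h, a h = s.card)
    (hT : T.SamplesThenFixes t₀ S 0) :
    |T.expectedComparisons a - cost u a| ≤ 2 * k * S + k * s.card * ((k + 1) / l + l / S) := by
  have hS0 : (S : ℝ) ≠ 0 := Nat.cast_ne_zero.mpr hS
  have hcost (t : ComparisonTree k) {c : Fin (k + 1) → ℕ} (hc : ∑ h, c h ≤ S) :
      |(cost t c : ℝ)| ≤ k * S := by
    rw [Nat.abs_cast]
    exact_mod_cast (cost_le t c).trans (Nat.mul_le_mul_left k hc)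
  have hsample := abs_expectedComparisons_sub_le_of_samplesThenFixes (M := cost u a)
    (α := k * S + k * s.card * ((k + 1) / l)) (β := k * s.card * (l / S ^ 2)) (by positivity)
    (fun hsmall => (hcost u hsmall).trans (le_add_of_nonneg_right (by positivity)))
    (proportion a)
    (fun c R t hcR hc ht => by
      subst hcR
      have hfixed := ht.abs_cost_add_sub_le hu (hc ▸ hS) hl
      rw [ha, hc, cost_add, Nat.cast_add, add_sub_assoc] at hfixed
      have htriangle := abs_sub (cost t c + ((cost t R : ℝ) - cost u (c + R))) (cost t c)
      rw [add_sub_cancel_left] at htriangle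
      calc |(cost t R : ℝ) - cost u (c + R)|
          ≤ k * s.card * ((k + 1) / l + l * (deviation (proportion (c + R)) R / S ^ 2))
            + k * S := htriangle.trans (add_le_add hfixed (hcost t hc.le))
        _ = _ := by ring)
    (zero_add a) ha (by simp) hT
  rw [deviation_proportion_self, zero_add] at hsample
  refine hsample.trans_eq ?_
  field_simp
  ring

end ClassificationTree

theorem rpow_three_fourths_eq {x : ℝ} (hx : 0 ≤ x) :
    x ^ (3 / 4 : ℝ) = (x ^ (1 / 4 : ℝ)) ^ 3 := by
  rw [← Real.rpow_mul_natCast hx]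
  norm_num

theorem rpow_one_fourth_pow_four {x : ℝ} (hx : 0 ≤ x) : (x ^ (1 / 4 : ℝ)) ^ 4 = x := by
  rw [← Real.rpow_mul_natCast hx]
  norm_num

theorem one_le_rpow_one_fourth (hn : n ≠ 0) : 1 ≤ (n : ℝ) ^ (1 / 4 : ℝ) :=
  Real.one_le_rpow (Nat.one_le_cast.mpr (Nat.one_le_iff_ne_zero.mpr hn)) (by norm_num)

theorem harmonic_le_three_mul_sq {m : ℕ} {x : ℝ} (hx : 1 ≤ x) (hm : m ≤ x ^ 4) :
    (harmonic m : ℝ) ≤ 3 * x ^ 2 := by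
  have hlog : Real.log m ≤ 2 * x ^ 2 := by
    have hsqrt : √(m : ℝ) ≤ x ^ 2 := Real.sqrt_le_iff.mpr ⟨by positivity, hm.trans_eq (by ring)⟩
    have hrpow := Real.log_le_rpow_div m.cast_nonneg one_half_pos
    rw [← Real.sqrt_eq_rpow] at hrpow
    linarith
  linarith [harmonic_le_one_add_log m, one_le_pow₀ (n := 2) hx]

theorem abs_expectedComparisons_sub_cost_le_rpow
    {P : (Fin (k + 1) → ℕ) → ComparisonTree k → Prop} {u : ComparisonTree k} (hn : n ≠ 0)
    (hP : ∀ c R t, c + R = a → P c t →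
      |meanDepth t R - meanDepth u a| ≤ k * ∑ h, |proportion R h - proportion a h|)
    (ha : ∑ h, a h = s.card) (hT : T.AllNodes P 0) :
    |T.expectedComparisons a - cost u a| ≤ k * (k + 4) / 2 * (n : ℝ) ^ (3 / 4 : ℝ) := by
  rw [rpow_three_fourths_eq n.cast_nonneg]
  set x := (n : ℝ) ^ (1 / 4 : ℝ) with hx
  have hx1 : 1 ≤ x := one_le_rpow_one_fourth hn
  have hs : (s.card : ℝ) ≤ x ^ 4 := by
    rw [hx, rpow_one_fourth_pow_four n.cast_nonneg]
    exact_mod_cast card_finset_fin_le s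
  calc |T.expectedComparisons a - cost u a|
      ≤ k * (((k + 1) / x * s.card + x * harmonic s.card) / 2) :=
        T.abs_expectedComparisons_sub_cost_le_of_allNodes (by positivity) hP ha hT
    _ ≤ k * (((k + 1) / x * x ^ 4 + x * (3 * x ^ 2)) / 2) := by
        gcongr
        exact harmonic_le_three_mul_sq hx1 hs
    _ = k * (k + 4) / 2 * x ^ 3 := by
        field_simp
        ring

theorem IsO.abs_expectedComparisons_sub_cost_le {S : Strategy k n} (hS : IsO S) (hn : n ≠ 0)
    (ha : ∑ h, a h = n - k) {u : ComparisonTree k} (hu : IsCostMinimal a u) :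
    |(S a).expectedComparisons a - cost u a| ≤ k * (k + 4) / 2 * (n : ℝ) ^ (3 / 4 : ℝ) := by
  refine abs_expectedComparisons_sub_cost_le_rpow hn ?_ (by rw [ha, card_nonPivots]) (hS a ha)
  rintro c R t rfl ht
  have htR : IsCostMinimal R t := by simpa using ht le_self_add
  exact htR.abs_meanDepth_sub_le hu

theorem IsN.abs_expectedComparisons_sub_cost_le {S : Strategy k n} (hS : IsN S) (hn : n ≠ 0)
    (ha : ∑ h, a h = n - k) {u : ComparisonTree k} (hu : IsCostMinimal a u) :
    |(S a).expectedComparisons a - cost u a| ≤ k * (k + 4) / 2 * (n : ℝ) ^ (3 / 4 : ℝ) := by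
  refine abs_expectedComparisons_sub_cost_le_rpow hn ?_ (by rw [ha, card_nonPivots]) (hS a ha)
  intro c R t _ ht
  rw [(hu.meanDepth_le t).antisymm (ht.meanDepth_le u)]
  exact abs_meanDepth_sub_le t R a

theorem IsSP.abs_expectedComparisons_sub_cost_le {t₀ : ComparisonTree k}
    {T : ClassificationTree k (nonPivots n k)} (hT : IsSP t₀ T) (hn : n ≠ 0)
    (ha : ∑ h, a h = n - k) {u : ComparisonTree k} (hu : IsCostMinimal a u) :
    |T.expectedComparisons a - cost u a| ≤ k * (k + 7) * (n : ℝ) ^ (3 / 4 : ℝ) := by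
  obtain ⟨S, hS, hsample⟩ := hT
  rw [rpow_three_fourths_eq n.cast_nonneg] at hS ⊢
  rw [abs_lt] at hS
  set x := (n : ℝ) ^ (1 / 4 : ℝ) with hx
  have hx1 : 1 ≤ x := one_le_rpow_one_fourth hn
  have hx3 : 1 ≤ x ^ 3 := one_le_pow₀ hx1
  have hS0 : (0 : ℝ) < S := by linarith
  have hS1 : (1 : ℝ) ≤ S := by exact_mod_cast hS0
  have hcard : ((nonPivots n k).card : ℝ) ≤ x ^ 4 := by
    rw [hx, rpow_one_fourth_pow_four n.cast_nonneg]
    exact_mod_cast card_finset_fin_le _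
  calc |T.expectedComparisons a - cost u a|
      ≤ 2 * k * S + k * (nonPivots n k).card * ((k + 1) / x + x / S) :=
        T.abs_expectedComparisons_sub_cost_le_of_samplesThenFixes
          (Nat.cast_ne_zero.mp hS0.ne') (by positivity) hu
          (by rw [ha, card_nonPivots]) hsample
    _ ≤ 2 * k * (2 * x ^ 3) + k * x ^ 4 * ((k + 1) / x + x / (x ^ 3 / 2)) := by
        gcongr <;> linarith
    _ = k * ((k + 5) * x ^ 3 + 2 * x ^ 2) := by
        field_simp
        ring
    _ ≤ k * ((k + 5) * x ^ 3 + 2 * x ^ 3) := by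
        gcongr
        norm_num
    _ = k * (k + 7) * x ^ 3 := by ring

theorem IsSP.abs_avgComparisons_sub_le {t₀ : ComparisonTree k}
    {T : ClassificationTree k (nonPivots n k)} (hT : IsSP t₀ T) (hn : n ≠ 0) {S : Strategy k n}
    {C : ℝ}
    (hS : ∀ a u, ∑ h, a h = n - k → IsCostMinimal a u →
      |(S a).expectedComparisons a - cost u a| ≤ C * (n : ℝ) ^ (3 / 4 : ℝ)) :
    |avgComparisons (fun _ => T) - avgComparisons S|
      ≤ (k * (k + 7) + C) * (n : ℝ) ^ (3 / 4 : ℝ) := by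
  refine KPivot.abs_avgComparisons_sub_le fun a ha => ?_
  obtain ⟨u, hu⟩ := exists_isCostMinimal a
  have hTu := hT.abs_expectedComparisons_sub_cost_le hn ha hu
  have hSu := hS a u ha hu
  rw [abs_sub_comm] at hSu
  rw [add_mul]
  exact (abs_sub_le _ _ _).trans (add_le_add hTu hSu)

end Estimates

end KPivot

theorem mainTheorem6 :
    ∃ ε : ℝ, 0 < ε ∧ ∀ k : ℕ, 1 ≤ k → ∃ C : ℝ, ∀ n : ℕ, k ≤ n →
      ∀ (t₀ : KPivot.ComparisonTree k) (T : KPivot.ClassificationTree k (KPivot.nonPivots n k)),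
        KPivot.IsSP t₀ T →
          (∀ S : KPivot.Strategy k n, KPivot.IsO S →
            |KPivot.avgComparisons (fun _ => T) - KPivot.avgComparisons S|
              ≤ C * (n : ℝ) ^ (1 - ε)) ∧
          (∀ S : KPivot.Strategy k n, KPivot.IsN S →
            |KPivot.avgComparisons (fun _ => T) - KPivot.avgComparisons S|
              ≤ C * (n : ℝ) ^ (1 - ε)) := by
  refine ⟨1 / 4, by norm_num, fun k hk => ⟨k * (k + 7) + k * (k + 4) / 2, fun n hkn t₀ T hT => ?_⟩⟩
  have hn : n ≠ 0 := by omega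
  have hexponent : (1 - 1 / 4 : ℝ) = 3 / 4 := by norm_num
  rw [hexponent]
  constructor <;> intro S hS <;>
    exact hT.abs_avgComparisons_sub_le hn fun a u ha hu =>
      hS.abs_expectedComparisons_sub_cost_le hn ha hu
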